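/- Formulas are built from propositional letters, $\bot$ and $\top$ with the binary connectives $\wedge,\vee,\cdot,\rightarrow,\leftarrow$. Formula structures are built from formulas with two binary operations $\odot$ and $\barwedge$ (there is no empty structure). A sequent is an expression $\Gamma\Rightarrow A$ with $\Gamma$ a formula structure and $A$ a formula; $\Gamma[\Delta]$ denotes a structure with a distinguished occurrence of the substructure $\Delta$. The sequent calculus $\mathsf{L^m_{RBL}}$ has the axioms $A\Rightarrow A$, $A\Rightarrow\top$ and $\bot\Rightarrow A$ (for formulas $A$), the logical rules $$\frac{\Delta\Rightarrow A\quad \Gamma[B]\Rightarrow C}{\Gamma[\Delta\odot(A\rightarrow B)]\Rightarrow C}\qquad \frac{A\odot\Gamma\Rightarrow B}{\Gamma\Rightarrow A\rightarrow B}\qquad \frac{\Gamma[A]\Rightarrow C\quad \Delta\Rightarrow B}{\Gamma[(A\leftarrow B)\odot\Delta]\Rightarrow C}\qquad \frac{\Gamma\odot B\Rightarrow A}{\Gamma\Rightarrow A\leftarrow B}$$ $$\frac{\Gamma[A\odot B]\Rightarrow C}{\Gamma[A\cdot B]\Rightarrow C}\qquad \frac{\Gamma\Rightarrow A\quad \Delta\Rightarrow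 B}{\Gamma\odot\Delta\Rightarrow A\cdot B}\qquad \frac{\Gamma[A\barwedge B]\Rightarrow C}{\Gamma[A\wedge B]\Rightarrow C}\qquad \frac{\Gamma\Rightarrow A\quad \Gamma\Rightarrow B}{\Gamma\Rightarrow A\wedge B}$$ $$\frac{\Gamma[A]\Rightarrow C\quad \Gamma[B]\Rightarrow C}{\Gamma[A\vee B]\Rightarrow C}\qquad \frac{\Gamma\Rightarrow A_i}{\Gamma\Rightarrow A_1\vee A_2}\ (i=1,2),$$ the structural rules $$\frac{\Gamma[\Delta\barwedge\Delta]\Rightarrow A}{\Gamma[\Delta]\Rightarrow A}\qquad \frac{\Gamma[(\Lambda\odot\Delta)\odot\Delta]\Rightarrow A}{\Gamma[\Lambda\odot\Delta]\Rightarrow A}\qquad \frac{\Gamma[\Delta\barwedge\Lambda]\Rightarrow A}{\Gamma[\Lambda\barwedge\Delta]\Rightarrow A}$$ $$\frac{\Gamma[\Delta]\Rightarrow A}{\Gamma[\Delta'*\Delta]\Rightarrow A}\qquad \frac{\Gamma[\Delta]\Rightarrow A}{\Gamma[\Delta*\Delta']\Rightarrow A}\quad (*\in\{\barwedge,\odot\})$$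 $$\frac{\Gamma[(\Delta_1\barwedge\Delta_2)\barwedge\Delta_3]\Rightarrow A}{\Gamma[\Delta_1\barwedge(\Delta_2\barwedge\Delta_3)]\Rightarrow A}\qquad \frac{\Gamma[\Delta_1\barwedge(\Delta_2\barwedge\Delta_3)]\Rightarrow A}{\Gamma[(\Delta_1\barwedge\Delta_2)\barwedge\Delta_3]\Rightarrow A},$$ and the rule $$(\mathrm{Mix})\quad \frac{\Delta\Rightarrow A\qquad \Gamma[A]\ldots[A]\Rightarrow B}{\Gamma[\Delta]\ldots[\Delta]\Rightarrow B},$$ where $A$ is a formula, called the mix formula, and the conclusion results from the second premise by replacing one or more occurrences of $A$ as a substructure of its antecedent (not necessarily all of them) by the structure $\Delta$. **Theorem.** Every sequent $\Gamma\Rightarrow A$ that is derivable in $\mathsf{L^m_{RBL}}$ has a derivation in $\mathsf{L^m_{RBL}}$ in which every application of $(\mathrm{Mix})$ has mix formula $\bot$ or $\top$. -/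

import Mathlib

namespace RBL

universe u

/-- Formulas of residuated basic logic over a set `α` of propositional letters:
`p | ⊥ | ⊤ | A ∧ B | A ∨ B | A · B | A → B | A ← B`. -/
inductive Form (α : Type u) : Type u
  | var (p : α) : Form α
  | bot : Form α
  | top : Form α
  | and (A B : Form α) : Form α
  | or (A B : Form α) : Form α
  | prod (A B : Form α) : Form α
  /-- `imp A B` is `A → B`. -/
  | imp (A B : Form α) : Form α
  /-- `limp A B` is `A ← B`. -/
  | limp (A B : Form α) : Form α

/-- Formula structures, built from formulas with `⊙` (`odot`) and `⩓` (`owedge`).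
There is no empty structure. -/
inductive Str (α : Type u) : Type u
  | form (A : Form α) : Str α
  | odot (Γ Δ : Str α) : Str α
  | owedge (Γ Δ : Str α) : Str α

/-- One-hole contexts `Γ[ ]`. -/
inductive Ctx (α : Type u) : Type u
  | hole : Ctx α
  | odotL (Γ : Ctx α) (Δ : Str α) : Ctx α
  | odotR (Δ : Str α) (Γ : Ctx α) : Ctx α
  | owedgeL (Γ : Ctx α) (Δ : Str α) : Ctx α
  | owedgeR (Δ : Str α) (Γ : Ctx α) : Ctx α

/-- `Γ.fill Δ` is the structure `Γ[Δ]`. -/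
def Ctx.fill {α : Type u} : Ctx α → Str α → Str α
  | .hole, Θ => Θ
  | .odotL Γ Δ, Θ => .odot (Γ.fill Θ) Δ
  | .odotR Δ Γ, Θ => .odot Δ (Γ.fill Θ)
  | .owedgeL Γ Δ, Θ => .owedge (Γ.fill Θ) Δ
  | .owedgeR Δ Γ, Θ => .owedge Δ (Γ.fill Θ)

/-- Contexts `Γ[ ]…[ ]` with any number of holes. -/
inductive MCtx (α : Type u) : Type u
  | hole : MCtx α
  | form (A : Form α) : MCtx α
  | odot (Γ Δ : MCtx α) : MCtx α
  | owedge (Γ Δ : MCtx α) : MCtx α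

/-- `Γ.fill Δ` is `Γ[Δ]…[Δ]`: every hole of `Γ` is filled with the same structure `Δ`. -/
def MCtx.fill {α : Type u} : MCtx α → Str α → Str α
  | .hole, Θ => Θ
  | .form A, _ => .form A
  | .odot Γ Δ, Θ => .odot (Γ.fill Θ) (Δ.fill Θ)
  | .owedge Γ Δ, Θ => .owedge (Γ.fill Θ) (Δ.fill Θ)

/-- The number of holes. -/
def MCtx.numHoles {α : Type u} : MCtx α → ℕ
  | .hole => 1
  | .form _ => 0
  | .odot Γ Δ => Γ.numHoles + Δ.numHoles
  | .owedge Γ Δ => Γ.numHoles + Δ.numHoles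

/-- `Deriv Γ A` is the type of derivations (proof trees) of the sequent `Γ ⇒ A` in the
sequent calculus with the rule Mix. -/
inductive Deriv {α : Type u} : Str α → Form α → Type u
  | id (A : Form α) : Deriv (.form A) A
  | topAx (A : Form α) : Deriv (.form A) .top
  | botAx (A : Form α) : Deriv (.form .bot) A
  | impL (Γ : Ctx α) (Δ : Str α) (A B C : Form α) :
      Deriv Δ A → Deriv (Γ.fill (.form B)) C →
      Deriv (Γ.fill (.odot Δ (.form (.imp A B)))) C
  | impR (Γ : Str α) (A B : Form α) :
      Deriv (.odot (.form A) Γ) B → Deriv Γ (.imp A B)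
  | limpL (Γ : Ctx α) (Δ : Str α) (A B C : Form α) :
      Deriv (Γ.fill (.form A)) C → Deriv Δ B →
      Deriv (Γ.fill (.odot (.form (.limp A B)) Δ)) C
  | limpR (Γ : Str α) (A B : Form α) :
      Deriv (.odot Γ (.form B)) A → Deriv Γ (.limp A B)
  | prodL (Γ : Ctx α) (A B C : Form α) :
      Deriv (Γ.fill (.odot (.form A) (.form B))) C → Deriv (Γ.fill (.form (.prod A B))) C
  | prodR (Γ Δ : Str α) (A B : Form α) :
      Deriv Γ A → Deriv Δ B → Deriv (.odot Γ Δ) (.prod A B)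
  | andL (Γ : Ctx α) (A B C : Form α) :
      Deriv (Γ.fill (.owedge (.form A) (.form B))) C → Deriv (Γ.fill (.form (.and A B))) C
  | andR (Γ : Str α) (A B : Form α) :
      Deriv Γ A → Deriv Γ B → Deriv Γ (.and A B)
  | orL (Γ : Ctx α) (A B C : Form α) :
      Deriv (Γ.fill (.form A)) C → Deriv (Γ.fill (.form B)) C →
      Deriv (Γ.fill (.form (.or A B))) C
  | orR₁ (Γ : Str α) (A B : Form α) : Deriv Γ A → Deriv Γ (.or A B)
  | orR₂ (Γ : Str α) (A B : Form α) : Deriv Γ B → Deriv Γ (.or A B)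
  /-- contraction for `⩓` -/
  | owedgeC (Γ : Ctx α) (Δ : Str α) (A : Form α) :
      Deriv (Γ.fill (.owedge Δ Δ)) A → Deriv (Γ.fill Δ) A
  /-- restricted contraction for `⊙` -/
  | odotC (Γ : Ctx α) (Λ Δ : Str α) (A : Form α) :
      Deriv (Γ.fill (.odot (.odot Λ Δ) Δ)) A → Deriv (Γ.fill (.odot Λ Δ)) A
  /-- exchange for `⩓` -/
  | owedgeE (Γ : Ctx α) (Δ Λ : Str α) (A : Form α) :
      Deriv (Γ.fill (.owedge Δ Λ)) A → Deriv (Γ.fill (.owedge Λ Δ)) A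
  /-- weakening on the left and on the right, for `⩓` and for `⊙` -/
  | owedgeW₁ (Γ : Ctx α) (Δ Δ' : Str α) (A : Form α) :
      Deriv (Γ.fill Δ) A → Deriv (Γ.fill (.owedge Δ' Δ)) A
  | odotW₁ (Γ : Ctx α) (Δ Δ' : Str α) (A : Form α) :
      Deriv (Γ.fill Δ) A → Deriv (Γ.fill (.odot Δ' Δ)) A
  | owedgeW₂ (Γ : Ctx α) (Δ Δ' : Str α) (A : Form α) :
      Deriv (Γ.fill Δ) A → Deriv (Γ.fill (.owedge Δ Δ')) A
  | odotW₂ (Γ : Ctx α) (Δ Δ' : Str α) (A : Form α) :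
      Deriv (Γ.fill Δ) A → Deriv (Γ.fill (.odot Δ Δ')) A
  /-- associativity for `⩓` -/
  | owedgeA₁ (Γ : Ctx α) (Δ₁ Δ₂ Δ₃ : Str α) (A : Form α) :
      Deriv (Γ.fill (.owedge (.owedge Δ₁ Δ₂) Δ₃)) A →
      Deriv (Γ.fill (.owedge Δ₁ (.owedge Δ₂ Δ₃))) A
  | owedgeA₂ (Γ : Ctx α) (Δ₁ Δ₂ Δ₃ : Str α) (A : Form α) :
      Deriv (Γ.fill (.owedge Δ₁ (.owedge Δ₂ Δ₃))) A →
      Deriv (Γ.fill (.owedge (.owedge Δ₁ Δ₂) Δ₃)) A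
  /-- Mix with mix formula `A`: at least one chosen occurrence of `A` is replaced by `Δ`.
  Unchosen occurrences of `A` may remain in the context `Γ`. -/
  | mix (Γ : MCtx α) (Δ : Str α) (A B : Form α) (h : 1 ≤ Γ.numHoles) :
      Deriv Δ A → Deriv (Γ.fill (.form A)) B → Deriv (Γ.fill Δ) B

/-- The set of mix formulas of all applications of Mix in a derivation. -/
def Deriv.mixFormulas {α : Type u} {Γ : Str α} {A : Form α} : Deriv Γ A → Set (Form α)
  | .id _ => ∅
  | .topAx _ => ∅
  | .botAx _ => ∅
  | .impL _ _ _ _ _ d e => d.mixFormulas ∪ e.mixFormulas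
  | .impR _ _ _ d => d.mixFormulas
  | .limpL _ _ _ _ _ d e => d.mixFormulas ∪ e.mixFormulas
  | .limpR _ _ _ d => d.mixFormulas
  | .prodL _ _ _ _ d => d.mixFormulas
  | .prodR _ _ _ _ d e => d.mixFormulas ∪ e.mixFormulas
  | .andL _ _ _ _ d => d.mixFormulas
  | .andR _ _ _ d e => d.mixFormulas ∪ e.mixFormulas
  | .orL _ _ _ _ d e => d.mixFormulas ∪ e.mixFormulas
  | .orR₁ _ _ _ d => d.mixFormulas
  | .orR₂ _ _ _ d => d.mixFormulas
  | .owedgeC _ _ _ d => d.mixFormulas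
  | .odotC _ _ _ _ d => d.mixFormulas
  | .owedgeE _ _ _ _ d => d.mixFormulas
  | .owedgeW₁ _ _ _ _ d => d.mixFormulas
  | .odotW₁ _ _ _ _ d => d.mixFormulas
  | .owedgeW₂ _ _ _ _ d => d.mixFormulas
  | .odotW₂ _ _ _ _ d => d.mixFormulas
  | .owedgeA₁ _ _ _ _ _ d => d.mixFormulas
  | .owedgeA₂ _ _ _ _ _ d => d.mixFormulas
  | .mix _ _ A _ _ d e => insert A (d.mixFormulas ∪ e.mixFormulas)

/-- Derivability of the sequent `Γ ⇒ A` in the calculus with Mix. -/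
def Derivable {α : Type u} (Γ : Str α) (A : Form α) : Prop := Nonempty (Deriv Γ A)

end RBL

/-! Following Okada, Mix elimination is read off from a completeness theorem. Relate a structure `Γ`
to a pair `(G, C)` when `G[Γ] ⇒ C` has a derivation without Mix, and interpret formulas by sets of
structures closed under the Galois connection of this relation. Every rule, Mix included, is sound:
the logical and structural rules hold for the closure, and Mix is the monotonicity of the
interpretation of a context in its holes. On the other hand the interpretation of `A` contains `A`
and consists of antecedents from which `A` is derivable without Mix. Evaluating a valid sequent
`Γ ⇒ A` at `Γ` itself therefore produces a derivation without Mix. -/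

namespace RBL

variable {α : Type*}

/-- Derivability without Mix. -/
def MixFree (Γ : Str α) (A : Form α) : Prop := ∃ d : Deriv Γ A, d.mixFormulas = ∅

theorem MixFree.map {Γ Δ : Str α} {A B : Form α} (h : MixFree Γ A) (f : Deriv Γ A → Deriv Δ B)
    (hf : ∀ d, (f d).mixFormulas = d.mixFormulas := by exact fun _ => rfl) : MixFree Δ B := by
  obtain ⟨d, hd⟩ := h
  exact ⟨f d, (hf d).trans hd⟩

theorem MixFree.map₂ {Γ Γ' Δ : Str α} {A A' B : Form α} (h : MixFree Γ A) (h' : MixFree Γ' A')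
    (f : Deriv Γ A → Deriv Γ' A' → Deriv Δ B)
    (hf : ∀ d e, (f d e).mixFormulas = d.mixFormulas ∪ e.mixFormulas := by
      exact fun _ _ => rfl) : MixFree Δ B := by
  obtain ⟨d, hd⟩ := h
  obtain ⟨e, he⟩ := h'
  exact ⟨f d e, by rw [hf, hd, he, Set.union_empty]⟩

theorem MixFree.fill_bot (G : Ctx α) (C : Form α) : MixFree (G.fill (.form .bot)) C := by
  induction G with
  | hole => exact ⟨.botAx C, rfl⟩
  | odotL Γ Δ ih => exact ih.map (.odotW₂ .hole _ Δ C)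
  | odotR Δ Γ ih => exact ih.map (.odotW₁ .hole _ Δ C)
  | owedgeL Γ Δ ih => exact ih.map (.owedgeW₂ .hole _ Δ C)
  | owedgeR Δ Γ ih => exact ih.map (.owedgeW₁ .hole _ Δ C)

theorem MixFree.top (Γ : Str α) : MixFree Γ .top := by
  induction Γ with
  | form A => exact ⟨.topAx A, rfl⟩
  | odot Γ Δ ih _ => exact ih.map (.odotW₂ .hole Γ Δ .top)
  | owedge Γ Δ ih _ => exact ih.map (.owedgeW₂ .hole Γ Δ .top)

/-- Composition of one-hole contexts: `G.comp H` is `G[H[ ]]`. -/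
def Ctx.comp : Ctx α → Ctx α → Ctx α
  | .hole, H => H
  | .odotL Γ Δ, H => .odotL (Γ.comp H) Δ
  | .odotR Δ Γ, H => .odotR Δ (Γ.comp H)
  | .owedgeL Γ Δ, H => .owedgeL (Γ.comp H) Δ
  | .owedgeR Δ Γ, H => .owedgeR Δ (Γ.comp H)

theorem Ctx.fill_comp (G H : Ctx α) (Γ : Str α) : (G.comp H).fill Γ = G.fill (H.fill Γ) := by
  induction G <;> simp_all only [Ctx.comp, Ctx.fill]

/-- The relation between structures `Γ` and pairs `(G, C)` whose Galois connection defines the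
semantics: `G[Γ] ⇒ C` is derivable without Mix. -/
def Fits (Γ : Str α) (p : Ctx α × Form α) : Prop := MixFree (p.1.fill Γ) p.2

/-- Closed sets of structures, the possible values of formulas: those of the form
`{Γ | G[Γ] ⇒ C is derivable without Mix for all (G, C) ∈ T}`. -/
abbrev Closed (S : Set (Str α)) : Prop := Order.IsExtent Fits S

/-- The smallest closed set containing `S`. -/
abbrev cl (S : Set (Str α)) : Set (Str α) := lowerPolar Fits (upperPolar Fits S)

theorem mem_cl_iff {S : Set (Str α)} {Γ : Str α} :
    Γ ∈ cl S ↔ ∀ (G : Ctx α) (C : Form α), (∀ Δ ∈ S, MixFree (G.fill Δ) C) → MixFree (G.fill Γ) C :=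
  Prod.forall

theorem mem_cl_of_fill {S : Set (Str α)} {Γ Δ : Str α} (hΔ : Δ ∈ S)
    (h : ∀ (G : Ctx α) (C : Form α), MixFree (G.fill Δ) C → MixFree (G.fill Γ) C) : Γ ∈ cl S :=
  mem_cl_iff.2 fun G C hS => h G C (hS Δ hΔ)

theorem Closed.mem_of_fill {X : Set (Str α)} (hX : Closed X) {Γ Δ : Str α} (hΔ : Δ ∈ X)
    (h : ∀ (G : Ctx α) (C : Form α), MixFree (G.fill Δ) C → MixFree (G.fill Γ) C) : Γ ∈ X :=
  hX.lowerPolar_upperPolar_subset subset_rfl (mem_cl_of_fill hΔ h)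

theorem closed_setOf_mixFree (A : Form α) : Closed {Γ : Str α | MixFree Γ A} :=
  ⟨{(.hole, A)}, Set.ext fun _ => mem_lowerPolar_singleton Fits⟩

theorem Closed.preimage_fill {X : Set (Str α)} (hX : Closed X) (H : Ctx α) :
    Closed (H.fill ⁻¹' X) := by
  obtain ⟨T, rfl⟩ := hX
  refine ⟨(fun p => (p.1.comp H, p.2)) '' T, Set.ext fun Γ => ?_⟩
  simp only [mem_lowerPolar_iff, Set.forall_mem_image, Set.mem_preimage, Fits, Ctx.fill_comp]

theorem Closed.image2_fill_cl_subset {X : Set (Str α)} (hX : Closed X) {𝒢 : Set (Ctx α)}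
    {S : Set (Str α)} (h : Set.image2 Ctx.fill 𝒢 S ⊆ X) : Set.image2 Ctx.fill 𝒢 (cl S) ⊆ X :=
  Set.image2_subset_iff.2 fun G hG => (hX.preimage_fill G).lowerPolar_upperPolar_subset
    fun _ hΓ => h (Set.mem_image2_of_mem hG hΓ)

section StructuralRules

variable (S T U : Set (Str α))

theorem subset_cl_owedge_self : S ⊆ cl (Set.image2 .owedge S S) := fun Γ hΓ =>
  mem_cl_of_fill (Set.mem_image2_of_mem hΓ hΓ) fun G C h => h.map (.owedgeC G Γ C)

theorem odot_subset_cl_odot_odot :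
    Set.image2 .odot S T ⊆ cl (Set.image2 .odot (Set.image2 .odot S T) T) := by
  rintro _ ⟨Γ, hΓ, Δ, hΔ, rfl⟩
  exact mem_cl_of_fill (Set.mem_image2_of_mem (Set.mem_image2_of_mem hΓ hΔ) hΔ)
    fun G C h => h.map (.odotC G Γ Δ C)

theorem owedge_subset_cl_owedge_swap :
    Set.image2 .owedge S T ⊆ cl (Set.image2 .owedge T S) := by
  rintro _ ⟨Γ, hΓ, Δ, hΔ, rfl⟩
  exact mem_cl_of_fill (Set.mem_image2_of_mem hΔ hΓ) fun G C h => h.map (.owedgeE G Δ Γ C)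

theorem owedge_subset_cl_left : Set.image2 .owedge S T ⊆ cl S := by
  rintro _ ⟨Γ, hΓ, Δ, -, rfl⟩
  exact mem_cl_of_fill hΓ fun G C h => h.map (.owedgeW₂ G Γ Δ C)

theorem owedge_subset_cl_right : Set.image2 .owedge S T ⊆ cl T := by
  rintro _ ⟨Γ, -, Δ, hΔ, rfl⟩
  exact mem_cl_of_fill hΔ fun G C h => h.map (.owedgeW₁ G Δ Γ C)

theorem odot_subset_cl_left : Set.image2 .odot S T ⊆ cl S := by
  rintro _ ⟨Γ, hΓ, Δ, -, rfl⟩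
  exact mem_cl_of_fill hΓ fun G C h => h.map (.odotW₂ G Γ Δ C)

theorem odot_subset_cl_right : Set.image2 .odot S T ⊆ cl T := by
  rintro _ ⟨Γ, -, Δ, hΔ, rfl⟩
  exact mem_cl_of_fill hΔ fun G C h => h.map (.odotW₁ G Δ Γ C)

theorem owedge_assoc_subset_cl :
    Set.image2 .owedge (Set.image2 .owedge S T) U ⊆
      cl (Set.image2 .owedge S (Set.image2 .owedge T U)) := by
  rintro _ ⟨_, ⟨Γ, hΓ, Δ, hΔ, rfl⟩, Λ, hΛ, rfl⟩
  exact mem_cl_of_fill (Set.mem_image2_of_mem hΓ (Set.mem_image2_of_mem hΔ hΛ))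
    fun G C h => h.map (.owedgeA₂ G Γ Δ Λ C)

theorem owedge_subset_cl_owedge_assoc :
    Set.image2 .owedge S (Set.image2 .owedge T U) ⊆
      cl (Set.image2 .owedge (Set.image2 .owedge S T) U) := by
  rintro _ ⟨Γ, hΓ, _, ⟨Δ, hΔ, Λ, hΛ, rfl⟩, rfl⟩
  exact mem_cl_of_fill (Set.mem_image2_of_mem (Set.mem_image2_of_mem hΓ hΔ) hΛ)
    fun G C h => h.map (.owedgeA₁ G Γ Δ Λ C)

end StructuralRules

theorem inter_subset_cl_owedge (S T : Set (Str α)) : S ∩ T ⊆ cl (Set.image2 .owedge S T) :=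
  (subset_cl_owedge_self _).trans <| lowerPolar_upperPolar_monotone Fits <|
    Set.image2_subset Set.inter_subset_left Set.inter_subset_right

/-- The interpretation of formulas by closed sets of structures. -/
def Form.sem : Form α → Set (Str α)
  | .var p => {Γ | MixFree Γ (.var p)}
  | .bot => cl ∅
  | .top => Set.univ
  | .and A B => A.sem ∩ B.sem
  | .or A B => cl (A.sem ∪ B.sem)
  | .prod A B => cl (Set.image2 .odot A.sem B.sem)
  | .imp A B => {Γ | ∀ Δ ∈ A.sem, .odot Δ Γ ∈ B.sem}
  | .limp A B => {Γ | ∀ Δ ∈ B.sem, .odot Γ Δ ∈ A.sem}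

theorem Form.closed_sem (A : Form α) : Closed A.sem := by
  induction A with
  | var p => exact closed_setOf_mixFree _
  | bot => exact Order.isExtent_lowerPolar
  | top => exact Order.IsExtent.univ
  | and A B hA hB => exact hA.inter hB
  | or A B _ _ => exact Order.isExtent_lowerPolar
  | prod A B _ _ => exact Order.isExtent_lowerPolar
  | imp A B _ hB =>
    simp only [Form.sem, Set.ofPred_forall]
    exact .iInter₂ _ fun Δ _ => hB.preimage_fill (.odotR Δ .hole)
  | limp A B hA _ =>
    simp only [Form.sem, Set.ofPred_forall]
    exact .iInter₂ _ fun Δ _ => hA.preimage_fill (.odotL .hole Δ)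

/-- The interpretation of structures: the structures obtained by replacing every formula
occurrence `A` by some member of `A.sem`. -/
def Str.sem : Str α → Set (Str α)
  | .form A => A.sem
  | .odot Γ Δ => Set.image2 .odot Γ.sem Δ.sem
  | .owedge Γ Δ => Set.image2 .owedge Γ.sem Δ.sem

/-- The interpretation of one-hole contexts, extending that of structures. -/
def Ctx.sem : Ctx α → Set (Ctx α)
  | .hole => {.hole}
  | .odotL Γ Δ => Set.image2 .odotL Γ.sem Δ.sem
  | .odotR Δ Γ => Set.image2 .odotR Δ.sem Γ.sem
  | .owedgeL Γ Δ => Set.image2 .owedgeL Γ.sem Δ.sem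
  | .owedgeR Δ Γ => Set.image2 .owedgeR Δ.sem Γ.sem

theorem Ctx.sem_fill (G : Ctx α) (Δ : Str α) :
    (G.fill Δ).sem = Set.image2 Ctx.fill G.sem Δ.sem := by
  induction G with
  | hole => simp only [Ctx.sem, Set.image2_singleton_left, Ctx.fill, Set.image_id']
  | odotL Γ Θ ih =>
    simp only [Ctx.fill, Str.sem, Ctx.sem, ih]
    exact Set.image2_right_comm fun _ _ _ => rfl
  | odotR Θ Γ ih =>
    simp only [Ctx.fill, Str.sem, Ctx.sem, ih]
    symm
    exact Set.image2_assoc fun _ _ _ => rfl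
  | owedgeL Γ Θ ih =>
    simp only [Ctx.fill, Str.sem, Ctx.sem, ih]
    exact Set.image2_right_comm fun _ _ _ => rfl
  | owedgeR Θ Γ ih =>
    simp only [Ctx.fill, Str.sem, Ctx.sem, ih]
    symm
    exact Set.image2_assoc fun _ _ _ => rfl

theorem MCtx.sem_fill_mono (G : MCtx α) {Δ Λ : Str α} (h : Δ.sem ⊆ Λ.sem) :
    (G.fill Δ).sem ⊆ (G.fill Λ).sem := by
  induction G with
  | hole => exact h
  | form A => exact subset_rfl
  | odot Γ Θ hΓ hΘ => exact Set.image2_subset hΓ hΘ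
  | owedge Γ Θ hΓ hΘ => exact Set.image2_subset hΓ hΘ

/-- Validity of the sequent `Γ ⇒ A` under the interpretation. -/
def Valid (Γ : Str α) (A : Form α) : Prop := Γ.sem ⊆ A.sem

theorem Valid.fill_of_sem_subset_cl {G : Ctx α} {Δ Λ : Str α} {C : Form α}
    (h : Valid (G.fill Δ) C) (hΛ : Λ.sem ⊆ cl Δ.sem) : Valid (G.fill Λ) C := by
  rw [Valid, Ctx.sem_fill] at h ⊢
  exact (Set.image2_subset_left hΛ).trans (C.closed_sem.image2_fill_cl_subset h)

theorem Valid.fill_of_sem_subset {G : Ctx α} {Δ Λ : Str α} {C : Form α}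
    (h : Valid (G.fill Δ) C) (hΛ : Λ.sem ⊆ Δ.sem) : Valid (G.fill Λ) C :=
  h.fill_of_sem_subset_cl (hΛ.trans (subset_lowerPolar_upperPolar Fits _))

theorem Valid.fill_or {G : Ctx α} {A B C : Form α} (hA : Valid (G.fill (.form A)) C)
    (hB : Valid (G.fill (.form B)) C) : Valid (G.fill (.form (.or A B))) C := by
  rw [Valid, Ctx.sem_fill] at hA hB ⊢
  refine C.closed_sem.image2_fill_cl_subset ?_
  rw [Set.image2_union_right]
  exact Set.union_subset hA hB

theorem Deriv.valid {Γ : Str α} {A : Form α} (d : Deriv Γ A) : Valid Γ A := by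
  induction d with
  | id A => exact subset_rfl
  | topAx A => exact Set.subset_univ _
  | botAx A => exact A.closed_sem.lowerPolar_upperPolar_subset (Set.empty_subset _)
  | impL G Δ A B C _ _ hA hB =>
    exact hB.fill_of_sem_subset <| Set.image2_subset_iff.2 fun _ hΔ _ hAB => hAB _ (hA hΔ)
  | impR Γ A _ _ h => exact fun _ hΓ _ hA => h (Set.mem_image2_of_mem hA hΓ)
  | limpL G Δ A B C _ _ hA hB =>
    exact hA.fill_of_sem_subset <| Set.image2_subset_iff.2 fun _ hAB _ hΔ => hAB _ (hB hΔ)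
  | limpR Γ _ B _ h => exact fun _ hΓ _ hB => h (Set.mem_image2_of_mem hΓ hB)
  | prodL G A B C _ h => exact h.fill_of_sem_subset_cl subset_rfl
  | prodR Γ Δ A B _ _ hA hB =>
    exact (Set.image2_subset hA hB).trans (subset_lowerPolar_upperPolar Fits _)
  | andL G A B C _ h => exact h.fill_of_sem_subset_cl (inter_subset_cl_owedge _ _)
  | andR Γ A B _ _ hA hB => exact Set.subset_inter hA hB
  | orL G A B C _ _ hA hB => exact hA.fill_or hB
  | orR₁ Γ A _ _ h =>
    exact (h.trans Set.subset_union_left).trans (subset_lowerPolar_upperPolar Fits _)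
  | orR₂ Γ _ B _ h =>
    exact (h.trans Set.subset_union_right).trans (subset_lowerPolar_upperPolar Fits _)
  | owedgeC G Δ A _ h => exact h.fill_of_sem_subset_cl (subset_cl_owedge_self _)
  | odotC G Λ Δ A _ h => exact h.fill_of_sem_subset_cl (odot_subset_cl_odot_odot _ _)
  | owedgeE G Δ Λ A _ h => exact h.fill_of_sem_subset_cl (owedge_subset_cl_owedge_swap _ _)
  | owedgeW₁ G Δ Λ A _ h => exact h.fill_of_sem_subset_cl (owedge_subset_cl_right _ _)
  | odotW₁ G Δ Λ A _ h => exact h.fill_of_sem_subset_cl (odot_subset_cl_right _ _)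
  | owedgeW₂ G Δ Λ A _ h => exact h.fill_of_sem_subset_cl (owedge_subset_cl_left _ _)
  | odotW₂ G Δ Λ A _ h => exact h.fill_of_sem_subset_cl (odot_subset_cl_left _ _)
  | owedgeA₁ G Δ₁ Δ₂ Δ₃ A _ h =>
    exact h.fill_of_sem_subset_cl (owedge_subset_cl_owedge_assoc _ _ _)
  | owedgeA₂ G Δ₁ Δ₂ Δ₃ A _ h => exact h.fill_of_sem_subset_cl (owedge_assoc_subset_cl _ _ _)
  | mix G Δ A B _ _ _ hA hB => exact (G.sem_fill_mono (Λ := .form A) hA).trans hB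

/-- Adequacy of the interpretation at the formula `A`, the invariant of the completeness proof:
`A.sem` lies between `{A}` and the set of antecedents from which `A` is derivable without Mix. -/
structure Form.Adequate (A : Form α) : Prop where
  form_mem_sem : .form A ∈ A.sem
  sem_subset : A.sem ⊆ {Γ | MixFree Γ A}

namespace Form.Adequate

variable {A B : Form α}

theorem var (p : α) : (Form.var p).Adequate := ⟨⟨.id _, rfl⟩, subset_rfl⟩

theorem bot : (Form.bot : Form α).Adequate where
  form_mem_sem := mem_cl_iff.2 fun G C _ => .fill_bot G C
  sem_subset := (closed_setOf_mixFree _).lowerPolar_upperPolar_subset (Set.empty_subset _)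

theorem top : (Form.top : Form α).Adequate := ⟨trivial, fun Γ _ => .top Γ⟩

theorem and (hA : A.Adequate) (hB : B.Adequate) : (A.and B).Adequate where
  form_mem_sem :=
    ⟨A.closed_sem.mem_of_fill hA.form_mem_sem fun G C h =>
        (h.map (.owedgeW₂ G _ (.form B) C)).map (.andL G A B C),
      B.closed_sem.mem_of_fill hB.form_mem_sem fun G C h =>
        (h.map (.owedgeW₁ G _ (.form A) C)).map (.andL G A B C)⟩
  sem_subset Γ hΓ := (hA.sem_subset hΓ.1).map₂ (hB.sem_subset hΓ.2) (.andR Γ A B)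

theorem or (hA : A.Adequate) (hB : B.Adequate) : (A.or B).Adequate where
  form_mem_sem := mem_cl_iff.2 fun G C h =>
    (h _ (.inl hA.form_mem_sem)).map₂ (h _ (.inr hB.form_mem_sem)) (.orL G A B C)
  sem_subset := (closed_setOf_mixFree _).lowerPolar_upperPolar_subset <| Set.union_subset
    (fun Γ hΓ => (hA.sem_subset hΓ).map (.orR₁ Γ A B))
    (fun Γ hΓ => (hB.sem_subset hΓ).map (.orR₂ Γ A B))

theorem prod (hA : A.Adequate) (hB : B.Adequate) : (A.prod B).Adequate where
  form_mem_sem := mem_cl_iff.2 fun G C h =>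
    (h _ (Set.mem_image2_of_mem hA.form_mem_sem hB.form_mem_sem)).map (.prodL G A B C)
  sem_subset := (closed_setOf_mixFree _).lowerPolar_upperPolar_subset <|
    Set.image2_subset_iff.2 fun Γ hΓ Δ hΔ =>
      (hA.sem_subset hΓ).map₂ (hB.sem_subset hΔ) (.prodR Γ Δ A B)

theorem imp (hA : A.Adequate) (hB : B.Adequate) : (A.imp B).Adequate where
  form_mem_sem Δ hΔ := B.closed_sem.mem_of_fill hB.form_mem_sem fun G C h =>
    (hA.sem_subset hΔ).map₂ h (.impL G Δ A B C)
  sem_subset Γ hΓ := (hB.sem_subset (hΓ _ hA.form_mem_sem)).map (.impR Γ A B)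

theorem limp (hA : A.Adequate) (hB : B.Adequate) : (A.limp B).Adequate where
  form_mem_sem Δ hΔ := A.closed_sem.mem_of_fill hA.form_mem_sem fun G C h =>
    h.map₂ (hB.sem_subset hΔ) (.limpL G Δ A B C)
  sem_subset Γ hΓ := (hA.sem_subset (hΓ _ hB.form_mem_sem)).map (.limpR Γ A B)

end Form.Adequate

theorem Form.adequate (A : Form α) : A.Adequate := by
  induction A with
  | var p => exact .var p
  | bot => exact .bot
  | top => exact .top
  | and A B hA hB => exact hA.and hB
  | or A B hA hB => exact hA.or hB
  | prod A B hA hB => exact hA.prod hB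
  | imp A B hA hB => exact hA.imp hB
  | limp A B hA hB => exact hA.limp hB

theorem Str.mem_sem_self (Γ : Str α) : Γ ∈ Γ.sem := by
  induction Γ with
  | form A => exact A.adequate.form_mem_sem
  | odot Γ Δ hΓ hΔ => exact Set.mem_image2_of_mem hΓ hΔ
  | owedge Γ Δ hΓ hΔ => exact Set.mem_image2_of_mem hΓ hΔ

theorem Valid.mixFree {Γ : Str α} {A : Form α} (h : Valid Γ A) : MixFree Γ A :=
  A.adequate.sem_subset (h Γ.mem_sem_self)

end RBL

theorem mainTheorem2_general {α : Type*} (Γ : RBL.Str α) (A : RBL.Form α)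
    (h : RBL.Derivable Γ A) : ∃ d : RBL.Deriv Γ A, d.mixFormulas = ∅ := by
  obtain ⟨d⟩ := h
  exact d.valid.mixFree

theorem mainTheorem2 {α : Type*} (Γ : RBL.Str α) (A : RBL.Form α)
    (h : RBL.Derivable Γ A) :
    ∃ d : RBL.Deriv Γ A, ∀ C ∈ d.mixFormulas, C = RBL.Form.bot ∨ C = RBL.Form.top := by
  obtain ⟨d, hd⟩ := mainTheorem2_general Γ A h
  exact ⟨d, by simp [hd]⟩
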